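/- A packing coloring of a finite graph $G$ assigns a positive integer (a color) to every vertex so that any two distinct vertices of the same color $k$ are at distance at least $k+1$; the packing chromatic number $\chi_\rho(G)$ is the least $k$ such that $G$ has a packing coloring with colors from $\{1,\dots,k\}$. Let $Q_n$ be the hypercube with vertex set $\mathbb{Z}_2^n$, two vertices being adjacent if and only if they differ in exactly one coordinate, let $\Box$ denote the Cartesian product of graphs, and let $|G|$ be the number of vertices of $G$. The inequality $$\chi_\rho(G\,\Box\,H)\le\max\{\chi_\rho(G)\cdot|H|,\ \chi_\rho(H)\cdot|G|\}$$ does not hold for all finite graphs $G$ and $H$; it fails for $G=H=Q_7$. More precisely: 1. $\chi_\rho(Q_7)=49$ and $|Q_7|=128$, so for $G=H=Q_7$ the right-hand side equals $49\cdot128=6272$. 2. $Q_7\,\Box\,Q_7$ is isomorphic to $Q_{14}$. 3. In every packing coloring of $Q_{14}$, the colors $1,\dots,13$ together are used on at most $9958$ vertices, and at least $6426$ vertices have a color that no other vertex has. 4. $\chi_\rho(Q_{14})\ge 6439$; hence $\chi_\rho(Q_7\,\Box\,Q_7)>6272$. -/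

import Mathlib

/-- A packing coloring of `G`: positive integers are assigned to the vertices, and two distinct
vertices of the same color `k` are at distance at least `k + 1`. The distance is the extended one,
so vertices in different components are infinitely far apart. -/
def IsPackingColoring {V : Type*} (G : SimpleGraph V) (c : V → ℕ) : Prop :=
  (∀ v, 1 ≤ c v) ∧ ∀ u v, u ≠ v → c u = c v → ((c u + 1 : ℕ) : ℕ∞) ≤ G.edist u v

/-- `G` has a packing coloring with colors from `{1, ..., k}`. -/
def PackingColorable {V : Type*} (G : SimpleGraph V) (k : ℕ) : Prop :=
  ∃ c : V → ℕ, IsPackingColoring G c ∧ ∀ v, c v ≤ k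

/-- The packing chromatic number of a finite graph: the least `k` such that `G` has a packing
coloring with colors from `{1, ..., k}`. -/
noncomputable def packingChromaticNumber {V : Type*} [Finite V] (G : SimpleGraph V) : ℕ :=
  sInf {k : ℕ | PackingColorable G k}

/-- Every finite graph has a packing coloring (all colors distinct), so the minimum defining the
packing chromatic number is attained. -/
theorem packingColorable_natCard {V : Type*} [Finite V] (G : SimpleGraph V) :
    PackingColorable G (Nat.card V) := by
  refine ⟨fun v => (Finite.equivFin V v : ℕ) + 1, ⟨fun v => Nat.succ_pos _, ?_⟩, fun v => ?_⟩
  · intro u v huv h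
    exact absurd ((Finite.equivFin V).injective (Fin.ext (Nat.succ_injective h))) huv
  · exact (Finite.equivFin V v).isLt

/-- The hypercube of dimension `n`: binary vectors of length `n`, adjacent if and only if they
differ in exactly one coordinate. -/
def hypercube (n : ℕ) : SimpleGraph (Fin n → ZMod 2) where
  Adj x y := hammingDist x y = 1
  symm := ⟨fun x y h => by rw [hammingDist_comm]; exact h⟩
  loopless := ⟨fun x h => by simp at h⟩

open Finset
open scoped symmDiff

section Isoperimetry

/-- The largest number of edges spanned by `m` vertices of a hypercube. -/
def cubeEdgeBound (m : ℕ) : ℕ :=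
  if m ≤ 1 then 0 else cubeEdgeBound (m / 2) + cubeEdgeBound ((m + 1) / 2) + m / 2
termination_by m
decreasing_by all_goals omega

theorem cubeEdgeBound_of_le_one {m : ℕ} (h : m ≤ 1) : cubeEdgeBound m = 0 := by
  rw [cubeEdgeBound, if_pos h]

theorem cubeEdgeBound_two_mul (m : ℕ) : cubeEdgeBound (2 * m) = 2 * cubeEdgeBound m + m := by
  rcases Nat.eq_zero_or_pos m with rfl | h
  · simp [cubeEdgeBound_of_le_one]
  · rw [cubeEdgeBound, if_neg (by omega), show 2 * m / 2 = m by omega,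
      show (2 * m + 1) / 2 = m by omega]
    ring

theorem cubeEdgeBound_two_mul_add_one (m : ℕ) :
    cubeEdgeBound (2 * m + 1) = cubeEdgeBound m + cubeEdgeBound (m + 1) + m := by
  rcases Nat.eq_zero_or_pos m with rfl | h
  · simp [cubeEdgeBound_of_le_one]
  · rw [cubeEdgeBound, if_neg (by omega), show (2 * m + 1) / 2 = m by omega,
      show (2 * m + 1 + 1) / 2 = m + 1 by omega]

theorem cubeEdgeBound_add_le (a b : ℕ) :
    cubeEdgeBound a + cubeEdgeBound b + min a b ≤ cubeEdgeBound (a + b) := by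
  induction hn : a + b using Nat.strong_induction_on generalizing a b with
  | _ n ih =>
    subst hn
    have key : ∀ x y, x + y < a + b →
        cubeEdgeBound x + cubeEdgeBound y + min x y ≤ cubeEdgeBound (x + y) :=
      fun x y h => ih _ h x y rfl
    by_cases h0 : a + b ≤ 1
    · rw [cubeEdgeBound_of_le_one h0, cubeEdgeBound_of_le_one (show a ≤ 1 by omega),
        cubeEdgeBound_of_le_one (show b ≤ 1 by omega)]
      omega
    obtain ⟨x, rfl | rfl⟩ := Nat.even_or_odd' a <;> obtain ⟨y, rfl | rfl⟩ := Nat.even_or_odd' b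
    · have h := key x y (by omega)
      rw [← Nat.mul_add, cubeEdgeBound_two_mul, cubeEdgeBound_two_mul, cubeEdgeBound_two_mul]
      omega
    · have h := key x y (by omega)
      have h' := key x (y + 1) (by omega)
      rw [show 2 * x + (2 * y + 1) = 2 * (x + y) + 1 by ring, cubeEdgeBound_two_mul,
        cubeEdgeBound_two_mul_add_one, cubeEdgeBound_two_mul_add_one]
      rw [← add_assoc] at h'
      omega
    · have h := key x y (by omega)
      have h' := key (x + 1) y (by omega)
      rw [show 2 * x + 1 + 2 * y = 2 * (x + y) + 1 by ring, cubeEdgeBound_two_mul,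
        cubeEdgeBound_two_mul_add_one, cubeEdgeBound_two_mul_add_one]
      rw [show x + 1 + y = x + y + 1 by ring] at h'
      omega
    · have h := key x (y + 1) (by omega)
      have h' := key (x + 1) y (by omega)
      rw [show 2 * x + 1 + (2 * y + 1) = 2 * (x + y + 1) by ring, cubeEdgeBound_two_mul,
        cubeEdgeBound_two_mul_add_one, cubeEdgeBound_two_mul_add_one]
      rw [show x + 1 + y = x + y + 1 by ring] at h'
      rw [← add_assoc] at h
      omega

theorem two_mul_cubeEdgeBound_le (k m : ℕ) (h : m ≤ 2 ^ k) : 2 * cubeEdgeBound m ≤ k * m := by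
  induction k generalizing m with
  | zero => simp [cubeEdgeBound_of_le_one (show m ≤ 1 by simpa using h)]
  | succ k ih =>
    rw [pow_succ] at h
    obtain ⟨x, rfl | rfl⟩ := Nat.even_or_odd' m
    · have := ih x (by omega)
      rw [cubeEdgeBound_two_mul]
      nlinarith
    · have := ih x (by omega)
      have := ih (x + 1) (by omega)
      rw [cubeEdgeBound_two_mul_add_one]
      nlinarith

theorem cubeEdgeBound_seven (m : ℕ) (h : 22 ≤ m) (h' : m ≤ 64) :
    2 * cubeEdgeBound m + 57 ≤ 7 * m := by
  interval_cases m <;> simp [cubeEdgeBound]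

variable {α : Type*} [DecidableEq α]

theorem symmDiff_singleton_cancel (s : Finset α) (i : α) : s ∆ {i} ∆ {i} = s :=
  symmDiff_symmDiff_cancel_right _ _

theorem mem_symmDiff_singleton {s : Finset α} {i j : α} :
    j ∈ s ∆ {i} ↔ (j ∈ s ↔ j ≠ i) := by
  rw [Finset.mem_symmDiff, Finset.mem_singleton]; tauto

variable [Fintype α]

/-- The number of ordered pairs of adjacent vertices `s`, `s ∆ {i}` inside `S`. -/
def dartCount (S : Finset (Finset α)) : ℕ :=
  ∑ i, #{s ∈ S | s ∆ {i} ∈ S}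

theorem dartCount_split (S : Finset (Finset α)) (j : α) :
    dartCount S ≤ dartCount {s ∈ S | j ∈ s} + dartCount {s ∈ S | j ∉ s} +
      2 * min #{s ∈ S | j ∈ s} #{s ∈ S | j ∉ s} := by
  have hne : ∀ i ≠ j, #{s ∈ S | s ∆ {i} ∈ S} ≤
      #{s ∈ {s ∈ S | j ∈ s} | s ∆ {i} ∈ {s ∈ S | j ∈ s}} +
      #{s ∈ {s ∈ S | j ∉ s} | s ∆ {i} ∈ {s ∈ S | j ∉ s}} := by
    intro i hi
    rw [← card_filter_add_card_filter_not (s := {s ∈ S | s ∆ {i} ∈ S}) (fun s => j ∈ s)]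
    refine add_le_add (card_le_card fun s => ?_) (card_le_card fun s => ?_) <;>
    · simp only [mem_filter, mem_symmDiff_singleton]
      have := hi.symm
      tauto
  have hj : #{s ∈ S | s ∆ {j} ∈ S} ≤ 2 * min #{s ∈ S | j ∈ s} #{s ∈ S | j ∉ s} := by
    rw [← card_filter_add_card_filter_not (s := {s ∈ S | s ∆ {j} ∈ S}) (fun s => j ∈ s)]
    have inj : ∀ T : Set (Finset α), Set.InjOn (fun s : Finset α => s ∆ {j}) T :=
      fun T => (symmDiff_left_injective {j}).injOn
    have h1 : #{s ∈ {s ∈ S | s ∆ {j} ∈ S} | j ∈ s} ≤ #{s ∈ S | j ∈ s} :=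
      card_le_card fun s => by simp only [mem_filter]; tauto
    have h2 : #{s ∈ {s ∈ S | s ∆ {j} ∈ S} | j ∉ s} ≤ #{s ∈ S | j ∉ s} :=
      card_le_card fun s => by simp only [mem_filter]; tauto
    have h3 : #{s ∈ {s ∈ S | s ∆ {j} ∈ S} | j ∈ s} ≤ #{s ∈ S | j ∉ s} :=
      card_le_card_of_injOn (fun s => s ∆ {j})
        (fun s => by
          simp only [coe_filter, mem_filter, Set.mem_ofPred_eq, mem_symmDiff_singleton]
          tauto) (inj _)
    have h4 : #{s ∈ {s ∈ S | s ∆ {j} ∈ S} | j ∉ s} ≤ #{s ∈ S | j ∈ s} :=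
      card_le_card_of_injOn (fun s => s ∆ {j})
        (fun s => by
          simp only [coe_filter, mem_filter, Set.mem_ofPred_eq, mem_symmDiff_singleton]
          tauto) (inj _)
    omega
  unfold dartCount
  rw [← sum_add_distrib, ← add_sum_erase _ _ (mem_univ j), ← add_sum_erase _ _ (mem_univ j)]
  have := sum_le_sum (s := univ.erase j) fun i hi => hne i (ne_of_mem_erase hi)
  omega

/-- The edge-isoperimetric inequality in the hypercube. -/
theorem dartCount_le (S : Finset (Finset α)) : dartCount S ≤ 2 * cubeEdgeBound #S := by
  induction hn : #S using Nat.strong_induction_on generalizing S with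
  | _ n ih =>
    subst hn
    by_cases h1 : #S ≤ 1
    · have : dartCount S = 0 := by
        refine sum_eq_zero fun i _ => card_eq_zero.2 (filter_eq_empty_iff.2 fun s hs hs' => ?_)
        have := card_le_one.1 h1 s hs _ hs'
        have h := (mem_symmDiff_singleton (s := s) (i := i) (j := i))
        rw [← this] at h
        tauto
      omega
    obtain ⟨s, hs, t, ht, hst⟩ := one_lt_card.1 (not_le.1 h1)
    obtain ⟨j, hj⟩ : ∃ j, ¬(j ∈ s ↔ j ∈ t) := by
      by_contra! h
      exact hst (Finset.ext h)
    have hsum := card_filter_add_card_filter_not (s := S) (fun s => j ∈ s)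
    have hpos : 0 < #{s ∈ S | j ∈ s} ∧ 0 < #{s ∈ S | j ∉ s} := by
      rw [card_pos, card_pos]
      by_cases hjs : j ∈ s
      · exact ⟨⟨s, by simp [hs, hjs]⟩, ⟨t, by simp [ht]; tauto⟩⟩
      · exact ⟨⟨t, by simp [ht]; tauto⟩, ⟨s, by simp [hs, hjs]⟩⟩
    have ha := ih _ (by omega) {s ∈ S | j ∈ s} rfl
    have hb := ih _ (by omega) {s ∈ S | j ∉ s} rfl
    have hsplit := dartCount_split S j
    have hadd := cubeEdgeBound_add_le #{s ∈ S | j ∈ s} #{s ∈ S | j ∉ s}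
    rw [hsum] at hadd
    omega

end Isoperimetry

section Codes

variable {α : Type*} [DecidableEq α]

/-- A family of sets whose pairwise symmetric differences have at least `d` elements, that is,
a binary code of minimum distance at least `d`. -/
def IsCode (d : ℕ) (C : Finset (Finset α)) : Prop :=
  ∀ s ∈ C, ∀ t ∈ C, s ≠ t → d ≤ #(s ∆ t)

theorem IsCode.mono {d : ℕ} {C D : Finset (Finset α)} (h : IsCode d C) (hD : D ⊆ C) :
    IsCode d D :=
  fun s hs t ht => h s (hD hs) t (hD ht)

/-- A predicate that singles out one of the two parity classes of sets. -/
def IsParity (E : Finset α → Prop) : Prop :=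
  ∀ s t, Even #(s ∆ t) ↔ (E s ↔ E t)

theorem card_symmDiff_add_two_mul (s t : Finset α) : #(s ∆ t) + 2 * #(s ∩ t) = #s + #t := by
  have h1 := card_sdiff_add_card_inter s t
  have h2 := card_sdiff_add_card_inter t s
  have h3 : #(s ∆ t) = #(s \ t) + #(t \ s) := by
    rw [symmDiff_def, sup_eq_union, card_union_of_disjoint disjoint_sdiff_sdiff]
  rw [inter_comm] at h2
  omega

theorem isParity_even : IsParity fun s : Finset α => Even #s := by
  intro s t
  have := card_symmDiff_add_two_mul s t
  rw [← Nat.even_add, ← this, Nat.even_add]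
  simp

theorem IsParity.not {E : Finset α → Prop} (hE : IsParity E) : IsParity fun s => ¬E s := by
  intro s t
  rw [hE]
  tauto

theorem IsParity.flip {E : Finset α → Prop} (hE : IsParity E) (s : Finset α) (i : α) :
    E (s ∆ {i}) ↔ ¬E s := by
  have := hE s (s ∆ {i})
  rw [symmDiff_symmDiff_cancel_left] at this
  simp at this
  tauto

theorem IsCode.even_of_parity {E : Finset α → Prop} (hE : IsParity E) {d : ℕ} (hd : Odd d)
    {C : Finset (Finset α)} (h : IsCode d C) (hC : ∀ s ∈ C, E s) : IsCode (d + 1) C := by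
  intro s hs t ht hst
  have h1 := h s hs t ht hst
  have h2 : Even #(s ∆ t) := (hE s t).2 (by simp [hC s hs, hC t ht])
  rcases h1.eq_or_lt with h3 | h3
  · rw [← h3] at h2
    exact absurd h2 (Nat.not_even_iff_odd.2 hd)
  · exact h3

theorem card_filter_powerset_card_le {β : Type*} (J : Finset β) (e : ℕ) :
    #{A ∈ J.powerset | #A ≤ e} = ∑ i ∈ range (e + 1), (#J).choose i := by
  rw [card_eq_sum_card_fiberwise (f := card) (t := range (e + 1))]
  · refine sum_congr rfl fun i hi => ?_
    rw [← card_powersetCard]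
    congr 1
    ext A
    simp only [mem_filter, mem_powerset, mem_powersetCard, mem_range] at hi ⊢
    constructor
    · tauto
    · rintro ⟨h, rfl⟩
      exact ⟨⟨h, by omega⟩, rfl⟩
  · intro A hA
    simp only [coe_filter, Set.mem_ofPred_eq, coe_range, Set.mem_Iio] at hA ⊢
    omega

/-- The sphere-packing bound for a code punctured to the coordinates in `J`. -/
theorem card_mul_ball_le (C : Finset (Finset α)) (J : Finset α) (e : ℕ)
    (h : ∀ s ∈ C, ∀ t ∈ C, s ≠ t → 2 * e + 1 ≤ #((s ∆ t) ∩ J)) :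
    #C * ∑ i ∈ range (e + 1), (#J).choose i ≤ 2 ^ #J := by
  rw [← card_filter_powerset_card_le, ← card_product, ← card_powerset]
  refine card_le_card_of_injOn (fun p => (p.1 ∩ J) ∆ p.2) ?_ ?_
  · rintro ⟨s, A⟩ hp
    simp only [coe_product, Set.mem_prod, mem_coe, mem_filter, mem_powerset] at hp ⊢
    intro x hx
    rw [mem_symmDiff, mem_inter] at hx
    rcases hx with hx | hx
    · exact hx.1.2
    · exact hp.2.1 hx.1
  · rintro ⟨s, A⟩ hp ⟨t, B⟩ hq heq
    simp only [coe_product, Set.mem_prod, mem_coe, mem_filter, mem_powerset] at hp hq heq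
    have hst : (s ∆ t) ∩ J ⊆ A ∪ B := by
      intro x hx
      have := Finset.ext_iff.1 heq x
      simp only [mem_symmDiff, mem_inter, mem_union] at this hx ⊢
      tauto
    have hcard := (card_le_card hst).trans (card_union_le A B)
    obtain rfl : s = t := by
      by_contra hne
      have := h s hp.1 t hq.1 hne
      omega
    rw [symmDiff_right_inj] at heq
    rw [heq]

variable [Fintype α]

theorem IsCode.card_mul_ball_le {C : Finset (Finset α)} {e : ℕ} (h : IsCode (2 * e + 1) C) :
    #C * ∑ i ∈ range (e + 1), (Fintype.card α).choose i ≤ 2 ^ Fintype.card α :=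
  _root_.card_mul_ball_le C univ e fun s hs t ht hst => by simpa using h s hs t ht hst

theorem IsCode.card_mul_punctured_ball_le [Nonempty α] {C : Finset (Finset α)} {e : ℕ}
    (h : IsCode (2 * e + 2) C) :
    #C * ∑ i ∈ range (e + 1), (Fintype.card α - 1).choose i ≤ 2 ^ (Fintype.card α - 1) := by
  obtain ⟨a⟩ := ‹Nonempty α›
  have := _root_.card_mul_ball_le C (univ.erase a) e fun s hs t ht hst => by
    have h1 := h s hs t ht hst
    rw [inter_erase, inter_univ]
    have := pred_card_le_card_erase (s := s ∆ t) (a := a)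
    omega
  rwa [card_erase_of_mem (mem_univ a), card_univ] at this

theorem IsCode.card_le_two {C : Finset (Finset α)} {d : ℕ} (h : IsCode d C)
    (hd : 2 * Fintype.card α < 3 * d) : #C ≤ 2 := by
  by_contra! hC
  obtain ⟨s, t, u, hs, ht, hu, hst, hsu, htu⟩ := two_lt_card_iff.1 hC
  have h1 := h s hs t ht hst
  have h2 := h s hs u hu hsu
  have h3 := h t ht u hu htu
  have hsub : t ∆ u ⊆ univ \ ((s ∆ t) ∩ (s ∆ u)) := by
    intro x
    simp only [mem_symmDiff, mem_sdiff, mem_univ, mem_inter]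
    tauto
  have h4 := card_le_card hsub
  rw [card_univ_sdiff] at h4
  have h5 := card_union_add_card_inter (s ∆ t) (s ∆ u)
  have h6 := card_le_univ (s ∆ t ∪ s ∆ u)
  have h7 := card_le_univ (s ∆ t ∩ s ∆ u)
  omega

/-- The Plotkin bound. -/
theorem IsCode.plotkin {C : Finset (Finset α)} {d : ℕ} (h : IsCode d C) :
    2 * d * (#C - 1) ≤ Fintype.card α * #C := by
  rcases Nat.eq_zero_or_pos #C with h0 | h0
  · simp [h0]
  have lower : #C * ((#C - 1) * d) ≤ ∑ s ∈ C, ∑ t ∈ C, #(s ∆ t) := by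
    rw [← smul_eq_mul]
    refine card_nsmul_le_sum _ _ _ fun s hs => ?_
    rw [← add_sum_erase _ _ hs, ← card_erase_of_mem hs, ← smul_eq_mul]
    refine le_add_left (card_nsmul_le_sum _ _ _ fun t ht => ?_)
    exact h s hs t (mem_of_mem_erase ht) (ne_of_mem_erase ht).symm
  have upper : 2 * ∑ s ∈ C, ∑ t ∈ C, #(s ∆ t) ≤ Fintype.card α * #C ^ 2 := by
    have hswap : ∑ s ∈ C, ∑ t ∈ C, #(s ∆ t) =
        ∑ j, 2 * (#{s ∈ C | j ∈ s} * #{s ∈ C | j ∉ s}) := by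
      have hc : ∀ s t : Finset α, #(s ∆ t) =
          ∑ j, ((if j ∈ s then 1 else 0) * (if j ∉ t then 1 else 0) +
            (if j ∉ s then 1 else 0) * (if j ∈ t then 1 else 0)) := by
        intro s t
        rw [← filter_mem_eq_of_subset (subset_univ (s ∆ t))]
        rw [card_filter]
        refine sum_congr rfl fun j _ => ?_
        by_cases h1 : j ∈ s <;> by_cases h2 : j ∈ t <;> simp [mem_symmDiff, h1, h2]
      simp_rw [hc]
      rw [sum_congr rfl fun s _ => sum_comm, sum_comm]
      refine sum_congr rfl fun j _ => ?_
      simp_rw [sum_add_distrib, ← mul_sum, ← sum_mul, ← card_filter]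
      ring
    rw [hswap, mul_sum, ← smul_eq_mul (Fintype.card α), ← card_univ]
    refine sum_le_card_nsmul _ _ _ fun j _ => ?_
    have := card_filter_add_card_filter_not (s := C) (fun s => j ∈ s)
    rw [← this]
    nlinarith [four_mul_le_sq_add #{s ∈ C | j ∈ s} #{s ∈ C | j ∉ s}]
  refine Nat.le_of_mul_le_mul_left (c := #C) ?_ h0
  calc #C * (2 * d * (#C - 1)) = 2 * (#C * ((#C - 1) * d)) := by ring
    _ ≤ Fintype.card α * #C ^ 2 := (Nat.mul_le_mul_left 2 lower).trans upper
    _ = #C * (Fintype.card α * #C) := by ring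

end Codes

section IndependentSets

variable {α : Type*} [DecidableEq α]

theorem IsCode.flip_notMem {I : Finset (Finset α)} (hI : IsCode 2 I) {s : Finset α} (hs : s ∈ I)
    (i : α) : s ∆ {i} ∉ I := by
  intro h
  have hne : s ≠ s ∆ {i} := by
    intro heq
    have := mem_symmDiff_singleton (s := s) (i := i) (j := i)
    rw [← heq] at this
    tauto
  have := hI s hs _ h hne
  rw [symmDiff_symmDiff_cancel_left, card_singleton] at this
  omega

variable [Fintype α]

theorem IsCode.card_flip_mem_le_one {Y : Finset (Finset α)} (hY : IsCode 3 Y) (p : Finset α) :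
    #{i | p ∆ {i} ∈ Y} ≤ 1 := by
  refine card_le_one.2 fun i hi j hj => ?_
  by_contra hij
  rw [mem_filter_univ] at hi hj
  have hne : p ∆ {i} ≠ p ∆ {j} := by
    rw [Ne, symmDiff_right_inj, singleton_inj]
    exact hij
  have h := hY _ hi _ hj hne
  have heq : (p ∆ {i}) ∆ (p ∆ {j}) = {i} ∆ {j} := by
    rw [symmDiff_comm p, symmDiff_assoc, symmDiff_symmDiff_cancel_left]
  have := card_symmDiff_add_two_mul ({i} : Finset α) {j}
  rw [card_singleton, card_singleton] at this
  rw [heq] at h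
  omega

variable {E : Finset α → Prop} [DecidablePred E]

theorem card_filter_flip (p : Finset α → Prop) [DecidablePred p] (i : α) :
    #{s : Finset α | p (s ∆ {i})} = #{s : Finset α | p s} := by
  refine card_nbij' (fun s => s ∆ {i}) (fun s => s ∆ {i}) ?_ ?_ ?_ ?_ <;>
    intro s <;> simp

theorem IsParity.two_mul_card [Nonempty α] (hE : IsParity E) :
    2 * #{s : Finset α | E s} = 2 ^ Fintype.card α := by
  obtain ⟨i⟩ := ‹Nonempty α›
  have h1 : #{s : Finset α | ¬E s} = #{s : Finset α | E s} := by
    rw [← card_filter_flip (fun s => E s) i]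
    simp only [hE.flip]
  have h2 : #{s : Finset α | E s} + #{s : Finset α | ¬E s} = #(univ : Finset (Finset α)) :=
    card_filter_add_card_filter_not _
  rw [card_univ, Fintype.card_finset] at h2
  omega

/-- In each direction, an independent set meets all edges except those that lie outside it. -/
theorem IsParity.card_uncovered (hE : IsParity E) {I : Finset (Finset α)} (hI : IsCode 2 I)
    (i : α) :
    #{s : Finset α | ¬E s ∧ s ∉ I ∧ s ∆ {i} ∉ I} + #I = #{s : Finset α | ¬E s} := by
  have h1 := card_filter_add_card_filter_not (s := ({s : Finset α | ¬E s} : Finset _)) (· ∈ I)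
  have h2 := card_filter_add_card_filter_not
    (s := ({s ∈ ({s : Finset α | ¬E s} : Finset _) | s ∉ I} : Finset _)) (· ∆ {i} ∈ I)
  have h3 : #{s ∈ I | E s} + #{s ∈ I | ¬E s} = #I := card_filter_add_card_filter_not _
  have h4 := card_filter_flip (fun s => E s ∧ s ∈ I) i
  simp only [filter_filter] at h1 h2
  have h5 : ({s : Finset α | (¬E s ∧ s ∉ I) ∧ s ∆ {i} ∈ I} : Finset _) =
      ({s : Finset α | E (s ∆ {i}) ∧ s ∆ {i} ∈ I} : Finset _) := by
    ext s
    simp only [mem_filter_univ, hE.flip]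
    have := fun h : s ∈ I => hI.flip_notMem h i
    tauto
  have h6 : ({s : Finset α | E s ∧ s ∈ I} : Finset _) = {s ∈ I | E s} := by
    ext s; simp [and_comm]
  have h7 : ({s : Finset α | ¬E s ∧ s ∈ I} : Finset _) = {s ∈ I | ¬E s} := by
    ext s; simp [and_comm]
  simp only [and_assoc] at h2 h5
  rw [h5, h4, h6] at h2
  rw [h7] at h1
  omega

/-- Isoperimetry bounds the deficit `t` of an independent set. -/
theorem IsParity.card_mul_le_deficit (hE : IsParity E) {I : Finset (Finset α)} (hI : IsCode 2 I)
    {t : ℕ} (ht : #I + t = #{s : Finset α | ¬E s}) :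
    Fintype.card α * (2 * #{s ∈ I | E s} + t) ≤
      Fintype.card α * t + 2 * cubeEdgeBound (2 * #{s ∈ I | E s} + t) := by
  set S : Finset (Finset α) := {s | E s ↔ s ∈ I} with hS
  have hcard : #S = 2 * #{s ∈ I | E s} + t := by
    have h1 : #{s ∈ S | E s} + #{s ∈ S | ¬E s} = #S := card_filter_add_card_filter_not _
    have h2 : #{s ∈ I | E s} + #{s ∈ I | ¬E s} = #I := card_filter_add_card_filter_not _
    have h3 := card_filter_add_card_filter_not (s := ({s : Finset α | ¬E s} : Finset _)) (· ∈ I)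
    have h4 : {s ∈ S | E s} = {s ∈ I | E s} := by
      ext s; simp only [hS, mem_filter, mem_univ, true_and]; tauto
    have h5 : {s ∈ S | ¬E s} = {s ∈ ({s : Finset α | ¬E s} : Finset _) | s ∉ I} := by
      ext s; simp only [hS, mem_filter, mem_univ, true_and]; tauto
    have h6 : {s ∈ ({s : Finset α | ¬E s} : Finset _) | s ∈ I} = {s ∈ I | ¬E s} := by
      ext s; simp only [mem_filter, mem_univ, true_and]; tauto
    rw [h4, h5] at h1
    rw [h6] at h3
    omega
  have hdart : ∀ i, #S = t + #{s ∈ S | s ∆ {i} ∈ S} := by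
    intro i
    have h1 := card_filter_add_card_filter_not (s := S) (· ∆ {i} ∈ S)
    have h2 := hE.card_uncovered hI i
    have h3 : {s ∈ S | s ∆ {i} ∉ S} = ({s | ¬E s ∧ s ∉ I ∧ s ∆ {i} ∉ I} : Finset _) := by
      ext s
      simp only [hS, mem_filter, mem_univ, true_and, hE.flip]
      have := fun h : s ∈ I => hI.flip_notMem h i
      tauto
    rw [h3] at h1
    omega
  have hsum : Fintype.card α * #S = Fintype.card α * t + dartCount S := by
    have := sum_congr rfl fun i (_ : i ∈ univ) => hdart i
    rw [sum_add_distrib] at this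
    simpa [dartCount] using this
  have := dartCount_le S
  rw [hcard] at hsum this
  omega

/-- Vertices outside an independent set `I` with few neighbours in `I` increase its deficit. -/
theorem IsParity.card_mul_le_of_disjoint (hE : IsParity E) {I Y : Finset (Finset α)}
    (hI : IsCode 2 I) {t m : ℕ} (ht : #I + t = #{s : Finset α | ¬E s}) (hY : ∀ s ∈ Y, ¬E s)
    (hIY : Disjoint I Y) (hm : ∀ p, #{i | p ∆ {i} ∈ Y} ≤ m) :
    Fintype.card α * #Y ≤ Fintype.card α * t + m * #{s ∈ I | E s} := by
  have hdir : ∀ i, #Y ≤ t + #{p ∈ {s ∈ I | E s} | p ∆ {i} ∈ Y} := by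
    intro i
    have h1 := card_filter_add_card_filter_not (s := Y) (· ∆ {i} ∈ I)
    have h2 := hE.card_uncovered hI i
    have h3 : #{s ∈ Y | s ∆ {i} ∉ I} ≤ #{s : Finset α | ¬E s ∧ s ∉ I ∧ s ∆ {i} ∉ I} := by
      refine card_le_card fun s hs => ?_
      rw [mem_filter] at hs
      rw [mem_filter_univ]
      exact ⟨hY s hs.1, fun h => disjoint_left.1 hIY h hs.1, hs.2⟩
    have h4 : #{s ∈ Y | s ∆ {i} ∈ I} ≤ #{p ∈ {s ∈ I | E s} | p ∆ {i} ∈ Y} := by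
      refine card_le_card_of_injOn (fun s => s ∆ {i}) (fun s hs => ?_)
        (symmDiff_left_injective {i}).injOn
      simp only [coe_filter, mem_filter, Set.mem_ofPred_eq, hE.flip,
        symmDiff_singleton_cancel] at hs ⊢
      exact ⟨⟨hs.2, hY s hs.1⟩, hs.1⟩
    omega
  have h1 := sum_le_sum fun i (_ : i ∈ univ) => hdir i
  have h2 : ∑ i, #{p ∈ {s ∈ I | E s} | p ∆ {i} ∈ Y} ≤ m * #{s ∈ I | E s} := by
    simp_rw [card_filter _ ({s ∈ I | E s})]
    rw [sum_comm]
    simp_rw [← card_filter]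
    rw [mul_comm, ← smul_eq_mul]
    exact sum_le_card_nsmul _ _ _ fun p _ => hm p
  rw [sum_add_distrib] at h1
  simp only [sum_const, card_univ, smul_eq_mul] at h1
  omega

/-- The vertices adjacent to `p`. -/
def flips (p : Finset α) : Finset (Finset α) :=
  univ.image fun i => p ∆ {i}

theorem card_flips (p : Finset α) : #(flips p) = Fintype.card α := by
  rw [flips, card_image_of_injective, card_univ]
  intro i j h
  simpa using h

theorem card_flips_inter_le {p q : Finset α} (h : p ≠ q) : #(flips p ∩ flips q) ≤ 2 := by
  rcases (flips p ∩ flips q).eq_empty_or_nonempty with h0 | ⟨r, hr⟩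
  · simp [h0]
  have hmem : ∀ r ∈ flips p ∩ flips q, ∃ i j, r = p ∆ {i} ∧ p ∆ q = {i} ∆ {j} := by
    intro r hr
    simp only [flips, mem_inter, mem_image, mem_univ, true_and] at hr
    obtain ⟨⟨i, hi⟩, j, hj⟩ := hr
    refine ⟨i, j, hi.symm, ?_⟩
    rw [← symmDiff_singleton_cancel p i, hi, ← hj, symmDiff_comm q, symmDiff_comm ({j} ∆ q),
      symmDiff_assoc, symmDiff_assoc, symmDiff_self]
    simp
  have hcard : #(p ∆ q) ≤ 2 := by
    obtain ⟨i, j, -, hpq⟩ := hmem r hr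
    have := card_symmDiff_add_two_mul ({i} : Finset α) {j}
    rw [hpq]
    simp only [card_singleton] at this
    omega
  refine (card_le_card (t := (p ∆ q).image fun i => p ∆ {i}) fun r hr => ?_).trans
    (card_image_le.trans hcard)
  obtain ⟨i, j, rfl, hpq⟩ := hmem r hr
  refine mem_image_of_mem _ ?_
  rw [hpq, mem_symmDiff, mem_singleton, mem_singleton]
  refine Or.inl ⟨rfl, ?_⟩
  rintro rfl
  rw [symmDiff_self] at hpq
  exact h (symmDiff_eq_bot.1 hpq)

theorem IsParity.card_add_card_flips_le (hE : IsParity E) {I : Finset (Finset α)}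
    (hI : IsCode 2 I) {P : Finset (Finset α)} (hP : P ⊆ {s ∈ I | E s}) :
    #{s ∈ I | ¬E s} + #(P.biUnion flips) ≤ #{s : Finset α | ¬E s} := by
  have key : ∀ s ∈ P.biUnion flips, ¬E s ∧ s ∉ I := by
    intro s hs
    simp only [flips, mem_biUnion, mem_image, mem_univ, true_and] at hs
    obtain ⟨p, hp, i, rfl⟩ := hs
    have := mem_filter.1 (hP hp)
    rw [hE.flip]
    exact ⟨not_not.2 this.2, hI.flip_notMem this.1 i⟩
  rw [← card_union_of_disjoint]
  · refine card_le_card fun s hs => ?_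
    rw [mem_filter_univ]
    rcases mem_union.1 hs with hs | hs
    · exact (mem_filter.1 hs).2
    · exact (key s hs).1
  · exact disjoint_left.2 fun s hs hs' => (key s hs').2 (mem_filter.1 hs).1

end IndependentSets

section PackingBounds

variable {α : Type*} [DecidableEq α]

/-- One of the two parity classes contains at most half of `I`. -/
theorem exists_parity_card_le (I : Finset (Finset α)) :
    ∃ (E : Finset α → Prop) (_ : DecidablePred E), IsParity E ∧
      #{s ∈ I | E s} ≤ #{s ∈ I | ¬E s} := by
  rcases le_total #{s ∈ I | Even #s} #{s ∈ I | ¬Even #s} with h | h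
  · exact ⟨_, inferInstance, isParity_even, h⟩
  · refine ⟨fun s => ¬Even #s, inferInstance, isParity_even.not, ?_⟩
    simpa only [not_not] using h

variable [Fintype α]

theorem IsParity.card_not_eq_two_pow {n : ℕ} (hα : Fintype.card α = n + 1) {E : Finset α → Prop}
    [DecidablePred E] (hE : IsParity E) : #{s : Finset α | ¬E s} = 2 ^ n := by
  have : Nonempty α := Fintype.card_pos_iff.1 (by omega)
  have := hE.not.two_mul_card
  rw [hα, pow_succ] at this
  omega

theorem sum_packing_fourteen_le (hα : Fintype.card α = 14) (X : ℕ → Finset (Finset α))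
    (hX : ∀ k, IsCode (k + 1) (X k)) (hdisj : ∀ j k, j ≠ k → Disjoint (X j) (X k)) :
    ∑ k ∈ Icc 1 13, #(X k) ≤ 9958 := by
  have : Nonempty α := Fintype.card_pos_iff.1 (by omega)
  obtain ⟨E, _, hE, hPR⟩ := exists_parity_card_le (X 1)
  have hsplit : ∀ Y : Finset (Finset α), #{s ∈ Y | E s} + #{s ∈ Y | ¬E s} = #Y :=
    fun Y => card_filter_add_card_filter_not _
  have h1 := hsplit (X 1)
  have h2 := hsplit (X 2)
  have hN := hE.card_not_eq_two_pow (n := 13) hα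
  obtain ⟨t, ht⟩ : ∃ t, #(X 1) + t = #{s : Finset α | ¬E s} := by
    obtain ⟨i⟩ := ‹Nonempty α›
    exact ⟨_, (add_comm _ _).trans (hE.card_uncovered (hX 1) i)⟩
  have hiso := hE.card_mul_le_deficit (hX 1) ht
  have hgap := hE.card_mul_le_of_disjoint (Y := {s ∈ X 2 | ¬E s}) (m := 1) (hX 1) ht (by simp)
    (disjoint_of_subset_right (filter_subset _ _) (hdisj 1 2 (by norm_num)))
    (((hX 2).mono (filter_subset _ _)).card_flip_mem_le_one)
  have h2E := IsCode.card_mul_punctured_ball_le (e := 1)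
    (((hX 2).mono (filter_subset (fun s => E s) _)).even_of_parity hE (by decide)
      fun s hs => (mem_filter.1 hs).2)
  have c2 := IsCode.card_mul_ball_le (e := 1) (hX 2)
  have c3 := IsCode.card_mul_punctured_ball_le (e := 1) (hX 3)
  have c4 := IsCode.card_mul_ball_le (e := 2) (hX 4)
  have c5 := IsCode.card_mul_punctured_ball_le (e := 2) (hX 5)
  have c6 := IsCode.card_mul_ball_le (e := 3) (hX 6)
  have c7 := IsCode.card_mul_punctured_ball_le (e := 3) (hX 7)
  have c8 := IsCode.card_mul_ball_le (e := 4) (hX 8)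
  have c9 := (hX 9).card_le_two (by omega)
  have c10 := (hX 10).card_le_two (by omega)
  have c11 := (hX 11).card_le_two (by omega)
  have c12 := (hX 12).card_le_two (by omega)
  have c13 := (hX 13).card_le_two (by omega)
  have hedge : 2 * #{s ∈ X 1 | E s} + t ≤ 8192 →
      2 * cubeEdgeBound (2 * #{s ∈ X 1 | E s} + t) ≤ 13 * (2 * #{s ∈ X 1 | E s} + t) :=
    fun h => two_mul_cubeEdgeBound_le 13 _ (by norm_num; exact h)
  have hsum : ∑ k ∈ Icc 1 13, #(X k) = #(X 1) + #(X 2) + #(X 3) + #(X 4) + #(X 5) + #(X 6) +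
      #(X 7) + #(X 8) + #(X 9) + #(X 10) + #(X 11) + #(X 12) + #(X 13) := by
    simp [sum_Icc_succ_top]
  rw [hα] at *
  norm_num [sum_range_succ, Nat.choose] at h2E c2 c3 c4 c5 c6 c7 c8 hN
  rw [hsum]
  omega

theorem IsCode.card_le_eight (hα : Fintype.card α = 7) {C : Finset (Finset α)}
    (h : IsCode 4 C) : #C ≤ 8 := by
  have := h.plotkin
  rw [hα] at this
  omega

/-- An independent set of the 7-dimensional hypercube that has at least two vertices in each
parity class misses the maximum size by at least nine. -/
theorem IsParity.nine_le_deficit (hα : Fintype.card α = 7) {E : Finset α → Prop} [DecidablePred E]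
    (hE : IsParity E) {I : Finset (Finset α)} (hI : IsCode 2 I) {t : ℕ} (ht : #I + t = 64)
    (hPR : #{s ∈ I | E s} ≤ #{s ∈ I | ¬E s}) (hP : 2 ≤ #{s ∈ I | E s}) : 9 ≤ t := by
  have hN := hE.card_not_eq_two_pow (n := 6) hα
  norm_num at hN
  have hsplit : #{s ∈ I | E s} + #{s ∈ I | ¬E s} = #I := card_filter_add_card_filter_not _
  have htwo : ∀ p q : Finset α, p ≠ q → 12 ≤ #(flips p ∪ flips q) := by
    intro p q hpq
    have h1 := card_union_add_card_inter (flips p) (flips q)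
    have h2 := card_flips_inter_le hpq
    rw [card_flips, card_flips, hα] at h1
    omega
  have h12 : 12 + #{s ∈ I | ¬E s} ≤ 64 := by
    obtain ⟨p, hp, q, hq, hpq⟩ := one_lt_card.1 hP
    have h1 := hE.card_add_card_flips_le hI (P := {p, q}) (by simp [insert_subset_iff, hp, hq])
    rw [biUnion_insert, singleton_biUnion, hN] at h1
    have := htwo p q hpq
    omega
  have h15 : 3 ≤ #{s ∈ I | E s} → 15 + #{s ∈ I | ¬E s} ≤ 64 := by
    intro h3
    obtain ⟨p, q, r, hp, hq, hr, hpq, hpr, hqr⟩ := two_lt_card_iff.1 h3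
    have h1 := hE.card_add_card_flips_le hI (P := {p, q, r})
      (by simp [insert_subset_iff, hp, hq, hr])
    rw [biUnion_insert, biUnion_insert, singleton_biUnion, hN] at h1
    have h2 := htwo q r hqr
    have h3 := card_union_add_card_inter (flips p) (flips q ∪ flips r)
    have h4 := card_union_le (flips p ∩ flips q) (flips p ∩ flips r)
    rw [← inter_union_distrib_left] at h4
    have h5 := card_flips_inter_le hpq
    have h6 := card_flips_inter_le hpr
    rw [card_flips, hα] at h3
    omega
  by_contra! hlt
  have hiso := hE.card_mul_le_deficit hI (ht.trans hN.symm)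
  have hedge := cubeEdgeBound_seven (2 * #{s ∈ I | E s} + t) (by omega) (by omega)
  rw [hα] at hiso
  omega

theorem sum_packing_seven_le (hα : Fintype.card α = 7) (X : ℕ → Finset (Finset α))
    (hX : ∀ k, IsCode (k + 1) (X k)) (hdisj : ∀ j k, j ≠ k → Disjoint (X j) (X k)) :
    ∑ k ∈ Icc 1 6, #(X k) ≤ 85 := by
  have : Nonempty α := Fintype.card_pos_iff.1 (by omega)
  obtain ⟨E, _, hE, hPR⟩ := exists_parity_card_le (X 1)
  have hsplit : ∀ Y : Finset (Finset α), #{s ∈ Y | E s} + #{s ∈ Y | ¬E s} = #Y :=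
    fun Y => card_filter_add_card_filter_not _
  have h1 := hsplit (X 1)
  have h2 := hsplit (X 2)
  have h6 := hsplit (X 6)
  have hN := hE.card_not_eq_two_pow (n := 6) hα
  norm_num at hN
  obtain ⟨t, ht⟩ : ∃ t, #(X 1) + t = #{s : Finset α | ¬E s} := by
    obtain ⟨i⟩ := ‹Nonempty α›
    exact ⟨_, (add_comm _ _).trans (hE.card_uncovered (hX 1) i)⟩
  have c2 := IsCode.card_mul_ball_le (e := 1) (hX 2)
  rw [hα] at c2
  norm_num [sum_range_succ] at c2
  have c3 := (hX 3).card_le_eight hα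
  have c4 := (hX 4).card_le_two (by omega)
  have c5 := (hX 5).card_le_two (by omega)
  have c6 := (hX 6).card_le_two (by omega)
  have hsum : ∑ k ∈ Icc 1 6, #(X k) =
      #(X 1) + #(X 2) + #(X 3) + #(X 4) + #(X 5) + #(X 6) := by
    simp [sum_Icc_succ_top]
  rw [hsum]
  rcases le_or_gt 2 #{s ∈ X 1 | E s} with hP | hP
  · have := hE.nine_le_deficit hα (hX 1) (ht.trans hN) hPR hP
    omega
  have h2E : #{s ∈ X 2 | E s} ≤ 8 := IsCode.card_le_eight hα
    (((hX 2).mono (filter_subset _ _)).even_of_parity hE (by decide)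
      fun s hs => (mem_filter.1 hs).2)
  have h6E : #{s ∈ X 6 | E s} ≤ 1 := by
    have hcode := ((hX 6).mono (filter_subset (fun s => E s) _)).even_of_parity hE (by decide)
      fun s hs => (mem_filter.1 hs).2
    refine card_le_one.2 fun s hs t ht => ?_
    by_contra hst
    have := hcode s hs t ht hst
    have := card_le_univ (s ∆ t)
    omega
  have hY := hE.card_mul_le_of_disjoint (Y := {s ∈ X 2 ∪ X 6 | ¬E s}) (m := 2) (hX 1) ht
    (by simp)
    (disjoint_of_subset_right (filter_subset _ _)
      (disjoint_union_right.2 ⟨hdisj 1 2 (by norm_num), hdisj 1 6 (by norm_num)⟩))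
    (fun p => by
      have h3 : IsCode 3 (X 6) := fun s hs t ht hst => by
        have := hX 6 s hs t ht hst
        omega
      have ha := (hX 2).card_flip_mem_le_one p
      have hb := h3.card_flip_mem_le_one p
      refine (card_le_card fun i hi => ?_).trans
        ((card_union_le {i | p ∆ {i} ∈ X 2} {i | p ∆ {i} ∈ X 6}).trans (add_le_add ha hb))
      simp only [mem_filter, mem_univ, true_and, mem_union] at hi ⊢
      exact hi.1)
  rw [filter_union, card_union_of_disjoint
    (disjoint_filter_filter (hdisj 2 6 (by norm_num))), hα] at hY
  omega

end PackingBounds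

section Hypercube

theorem SimpleGraph.edist_map_le {V W : Type*} {G : SimpleGraph V} {H : SimpleGraph W}
    (f : G →g H) (u v : V) : H.edist (f u) (f v) ≤ G.edist u v := by
  refine le_iInf fun w => ?_
  rw [← SimpleGraph.Walk.length_map f w]
  exact SimpleGraph.edist_le _

theorem PackingColorable.of_iso {V W : Type*} {G : SimpleGraph V} {H : SimpleGraph W}
    (e : G ≃g H) {k : ℕ} (h : PackingColorable G k) : PackingColorable H k := by
  obtain ⟨c, ⟨hpos, hc⟩, hk⟩ := h
  refine ⟨fun v => c (e.symm v), ⟨fun v => hpos _, fun u v huv huv' => ?_⟩, fun v => hk _⟩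
  exact (hc _ _ (e.symm.injective.ne huv) huv').trans
    (SimpleGraph.edist_map_le e.symm.toHom u v)

theorem packingChromaticNumber_congr {V W : Type*} [Finite V] [Finite W] {G : SimpleGraph V}
    {H : SimpleGraph W} (e : G ≃g H) : packingChromaticNumber G = packingChromaticNumber H := by
  unfold packingChromaticNumber
  congr 1
  ext k
  exact ⟨fun h => PackingColorable.of_iso e h, fun h => PackingColorable.of_iso e.symm h⟩

theorem hammingDist_append {m n : ℕ} {β : Type*} [DecidableEq β] (x x' : Fin m → β)
    (y y' : Fin n → β) :
    hammingDist (Fin.append x y) (Fin.append x' y') = hammingDist x x' + hammingDist y y' := by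
  simp only [hammingDist, card_filter, Fin.sum_univ_add, Fin.append_left, Fin.append_right]

/-- The Cartesian product of two hypercubes is a hypercube. -/
def hypercubeBoxProdIso (m n : ℕ) :
    (hypercube m).boxProd (hypercube n) ≃g hypercube (m + n) where
  toEquiv := Fin.appendEquiv m n
  map_rel_iff' := by
    rintro ⟨x, y⟩ ⟨x', y'⟩
    simp only [Fin.appendEquiv, Equiv.coe_fn_mk, hypercube, hammingDist_append,
      SimpleGraph.boxProd_adj, ← hammingDist_eq_zero (x := x), ← hammingDist_eq_zero (x := y)]
    omega

theorem edist_hypercube {n : ℕ} (x y : Fin n → ZMod 2) :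
    (hypercube n).edist x y = hammingDist x y := by
  apply le_antisymm
  · induction hk : hammingDist x y generalizing x with
    | zero => simp [hammingDist_eq_zero.1 hk]
    | succ k ih =>
      obtain ⟨i, hi⟩ : ∃ i, x i ≠ y i := by
        by_contra! h
        rw [funext h, hammingDist_self] at hk
        omega
      have h1 : hammingDist x (Function.update x i (y i)) = 1 := by
        rw [hammingDist, card_eq_one]
        refine ⟨i, ?_⟩
        ext j
        by_cases hj : j = i
        · subst hj; simpa using hi
        · simp [hj]
      have h2 : hammingDist (Function.update x i (y i)) y + 1 = hammingDist x y := by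
        rw [hammingDist, hammingDist,
          ← card_erase_add_one (s := {j | x j ≠ y j}) (a := i) (by simpa using hi)]
        congr 2
        ext j
        by_cases hj : j = i
        · subst hj; simp
        · simp [hj]
      have h3 : (hypercube n).edist x (Function.update x i (y i)) = 1 :=
        SimpleGraph.edist_eq_one_iff_adj.2 h1
      calc (hypercube n).edist x y
          ≤ (hypercube n).edist x (Function.update x i (y i)) +
            (hypercube n).edist (Function.update x i (y i)) y := SimpleGraph.edist_triangle
        _ ≤ 1 + k := by
          rw [h3]
          exact add_le_add le_rfl (ih _ (by omega))
        _ = ((k + 1 : ℕ) : ℕ∞) := by push_cast; ring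
  · refine le_iInf fun w => ?_
    rw [Nat.cast_le]
    induction w with
    | nil => simp
    | @cons u v _ h p ih =>
      rw [SimpleGraph.Walk.length_cons]
      have h1 : hammingDist u v = 1 := h
      refine (hammingDist_triangle _ v _).trans ?_
      rw [h1, add_comm]
      exact Nat.add_le_add_right ih 1

/-- The set of coordinates at which a binary vector does not vanish. -/
def binarySupport {n : ℕ} (x : Fin n → ZMod 2) : Finset (Fin n) :=
  {i | x i ≠ 0}

theorem hammingDist_eq_card_symmDiff {n : ℕ} (x y : Fin n → ZMod 2) :
    hammingDist x y = #(binarySupport x ∆ binarySupport y) := by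
  have key : ∀ a b : ZMod 2, a ≠ b ↔ (a ≠ 0 ∧ ¬b ≠ 0 ∨ b ≠ 0 ∧ ¬a ≠ 0) := by decide
  rw [hammingDist]
  congr 1
  ext i
  simp only [binarySupport, mem_symmDiff, mem_filter_univ]
  exact key _ _

theorem binarySupport_injective {n : ℕ} :
    Function.Injective (binarySupport : (Fin n → ZMod 2) → Finset (Fin n)) := by
  intro x y h
  rw [← hammingDist_eq_zero, hammingDist_eq_card_symmDiff, h]
  simp

theorem isPackingColoring_hypercube_iff {n : ℕ} {c : (Fin n → ZMod 2) → ℕ} :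
    IsPackingColoring (hypercube n) c ↔ (∀ v, 1 ≤ c v) ∧
      ∀ u v, u ≠ v → c u = c v → c u + 1 ≤ #(binarySupport u ∆ binarySupport v) := by
  simp only [IsPackingColoring, edist_hypercube, Nat.cast_le, hammingDist_eq_card_symmDiff]

/-- The supports of the vertices of color `k`. -/
def colorClass {n : ℕ} (c : (Fin n → ZMod 2) → ℕ) (k : ℕ) : Finset (Finset (Fin n)) :=
  ({v | c v = k} : Finset (Fin n → ZMod 2)).image binarySupport

theorem card_colorClass {n : ℕ} (c : (Fin n → ZMod 2) → ℕ) (k : ℕ) :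
    #(colorClass c k) = #{v | c v = k} :=
  card_image_of_injective _ binarySupport_injective

theorem disjoint_colorClass {n : ℕ} (c : (Fin n → ZMod 2) → ℕ) (j k : ℕ) (h : j ≠ k) :
    Disjoint (colorClass c j) (colorClass c k) := by
  rw [colorClass, colorClass, disjoint_image binarySupport_injective]
  refine disjoint_left.2 fun v hv hv' => h ?_
  rw [mem_filter_univ] at hv hv'
  rw [← hv, hv']

theorem IsPackingColoring.isCode {n : ℕ} {c : (Fin n → ZMod 2) → ℕ}
    (hc : IsPackingColoring (hypercube n) c) (k : ℕ) : IsCode (k + 1) (colorClass c k) := by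
  rw [isPackingColoring_hypercube_iff] at hc
  intro s hs t ht hst
  simp only [colorClass, mem_image, mem_filter_univ] at hs ht
  obtain ⟨u, rfl, rfl⟩ := hs
  obtain ⟨v, hv, rfl⟩ := ht
  exact hc.2 u v (fun h => hst (h ▸ rfl)) hv.symm

theorem card_color_mem_Icc {n : ℕ} (c : (Fin n → ZMod 2) → ℕ) (m : ℕ) :
    #{v | 1 ≤ c v ∧ c v ≤ m} = ∑ k ∈ Icc 1 m, #(colorClass c k) := by
  rw [card_eq_sum_card_fiberwise (f := c) (t := Icc 1 m)]
  · refine sum_congr rfl fun k hk => ?_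
    rw [card_colorClass, filter_filter]
    congr 1
    ext v
    simp only [mem_filter_univ, mem_Icc] at hk ⊢
    constructor
    · exact fun h => h.2
    · rintro rfl
      exact ⟨hk, rfl⟩
  · intro v hv
    simpa using hv

theorem IsPackingColoring.eq_of_le {n : ℕ} {c : (Fin n → ZMod 2) → ℕ}
    (hc : IsPackingColoring (hypercube n) c) {u v : Fin n → ZMod 2} (h : c u = c v)
    (hu : n ≤ c u) : u = v := by
  by_contra huv
  have h1 := (isPackingColoring_hypercube_iff.1 hc).2 u v huv h
  have h2 := card_le_univ (binarySupport u ∆ binarySupport v)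
  rw [Fintype.card_fin] at h2
  omega

theorem IsPackingColoring.two_pow_le {m k : ℕ} {c : (Fin (m + 1) → ZMod 2) → ℕ}
    (hc : IsPackingColoring (hypercube (m + 1)) c) (hk : ∀ v, c v ≤ k) :
    2 ^ (m + 1) ≤ #{v | 1 ≤ c v ∧ c v ≤ m} + (k - m) := by
  have h1 := card_filter_add_card_filter_not (s := (univ : Finset (Fin (m + 1) → ZMod 2)))
    (fun v => 1 ≤ c v ∧ c v ≤ m)
  have h2 : #{v | ¬(1 ≤ c v ∧ c v ≤ m)} ≤ k - m := by
    rw [show k - m = #(Ioc m k) by simp]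
    have hlt : ∀ v, ¬(1 ≤ c v ∧ c v ≤ m) → m < c v := fun v hv => by
      have := hc.1 v
      omega
    refine card_le_card_of_injOn c (fun v hv => ?_) fun u hu v hv huv => ?_
    · simp only [coe_filter, mem_univ, true_and, Set.mem_ofPred_eq] at hv
      simpa using ⟨hlt v hv, hk v⟩
    · simp only [coe_filter, mem_univ, true_and, Set.mem_ofPred_eq] at hu
      exact hc.eq_of_le huv (hlt u hu)
  rw [card_univ, Fintype.card_fun, ZMod.card, Fintype.card_fin] at h1
  omega

theorem packingColorable_packingChromaticNumber {V : Type*} [Finite V] (G : SimpleGraph V) :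
    PackingColorable G (packingChromaticNumber G) :=
  Nat.sInf_mem (s := {k | PackingColorable G k}) ⟨_, packingColorable_natCard G⟩

theorem IsPackingColoring.card_fourteen_le {c : (Fin 14 → ZMod 2) → ℕ}
    (hc : IsPackingColoring (hypercube 14) c) : #{v | 1 ≤ c v ∧ c v ≤ 13} ≤ 9958 := by
  rw [card_color_mem_Icc]
  exact sum_packing_fourteen_le (Fintype.card_fin 14) _ hc.isCode (disjoint_colorClass c)

theorem IsPackingColoring.card_seven_le {c : (Fin 7 → ZMod 2) → ℕ}
    (hc : IsPackingColoring (hypercube 7) c) : #{v | 1 ≤ c v ∧ c v ≤ 6} ≤ 85 := by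
  rw [card_color_mem_Icc]
  exact sum_packing_seven_le (Fintype.card_fin 7) _ hc.isCode (disjoint_colorClass c)

theorem le_packingChromaticNumber_fourteen : 6439 ≤ packingChromaticNumber (hypercube 14) := by
  obtain ⟨c, hc, hk⟩ := packingColorable_packingChromaticNumber (hypercube 14)
  have h1 : 2 ^ 14 ≤ #{v | 1 ≤ c v ∧ c v ≤ 13} + (packingChromaticNumber (hypercube 14) - 13) :=
    hc.two_pow_le hk
  have h2 := hc.card_fourteen_le
  norm_num at h1
  omega

theorem le_packingChromaticNumber_seven : 49 ≤ packingChromaticNumber (hypercube 7) := by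
  obtain ⟨c, hc, hk⟩ := packingColorable_packingChromaticNumber (hypercube 7)
  have h1 : 2 ^ 7 ≤ #{v | 1 ≤ c v ∧ c v ≤ 6} + (packingChromaticNumber (hypercube 7) - 6) :=
    hc.two_pow_le hk
  have h2 := hc.card_seven_le
  norm_num at h1
  omega

end Hypercube

section SevenUpperBound

/-- A partial packing coloring, in which `0` marks the uncolored vertices, extends to a packing
coloring by giving new colors to the uncolored vertices. -/
theorem packingColorable_of_partial {V : Type*} [Fintype V] {G : SimpleGraph V} {m r : ℕ}
    (c : V → ℕ) (hm : ∀ v, c v ≤ m)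
    (hc : ∀ u v, u ≠ v → c u = c v → c u ≠ 0 → ((c u + 1 : ℕ) : ℕ∞) ≤ G.edist u v)
    (hr : #{v | c v = 0} ≤ r) : PackingColorable G (m + r) := by
  classical
  let U : Finset V := {v | c v = 0}
  have hU : ∀ v, c v = 0 → v ∈ U := fun v hv => by simp [U, hv]
  let d : V → ℕ := fun v => if h : c v = 0 then m + 1 + U.equivFin ⟨v, hU v h⟩ else c v
  have hd0 : ∀ v (h : c v = 0), d v = m + 1 + U.equivFin ⟨v, hU v h⟩ := fun v h => dif_pos h
  have hd1 : ∀ v, c v ≠ 0 → d v = c v := fun v h => dif_neg h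
  refine ⟨d, ⟨fun v => ?_, fun u v huv h => ?_⟩, fun v => ?_⟩
  · by_cases h : c v = 0
    · rw [hd0 v h]; omega
    · rw [hd1 v h]; omega
  · by_cases hu : c u = 0 <;> by_cases hv : c v = 0
    · rw [hd0 u hu, hd0 v hv] at h
      have h' := U.equivFin.injective (Fin.ext (Nat.add_left_cancel h))
      exact absurd (Subtype.ext_iff.1 h') huv
    · rw [hd0 u hu, hd1 v hv] at h
      have := hm v
      omega
    · rw [hd1 u hu, hd0 v hv] at h
      have := hm u
      omega
    · rw [hd1 u hu, hd1 v hv] at h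
      rw [hd1 u hu]
      exact hc u v huv h hu
  · by_cases h : c v = 0
    · rw [hd0 v h]
      have := (U.equivFin ⟨v, hU v h⟩).isLt
      have : #U ≤ r := hr
      omega
    · rw [hd1 v h]
      exact (hm v).trans (Nat.le_add_right _ _)

/-- The lines of the Fano plane together with the whole plane. -/
def fanoCode : Finset (Finset (Fin 7)) :=
  insert univ (univ.image fun i : Fin 7 => {i, i + 1, i + 3})

/-- A translate of `fanoCode` by a set of even size. -/
def fanoCodeTranslate : Finset (Finset (Fin 7)) :=
  fanoCode.image (· ∆ {1, 2, 3, 4, 5, 6})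

/-- A partial packing coloring of the 7-dimensional hypercube with five colors. -/
def fanoColoring (s : Finset (Fin 7)) : ℕ :=
  if Even #s then 1
  else if s ∈ fanoCode then 2
  else if s ∈ fanoCodeTranslate then 3
  else if s = {1} ∨ s = {0, 3, 4, 5, 6} then 4
  else if s = {2} ∨ s = {0, 1, 4, 5, 6} then 5
  else 0

theorem card_fanoColoring_eq_zero : #{s | fanoColoring s = 0} = 44 := by
  decide +kernel

theorem isCode_fanoCode : IsCode 4 fanoCode := by
  unfold IsCode
  decide +kernel

theorem isCode_fanoCodeTranslate : IsCode 4 fanoCodeTranslate := by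
  unfold IsCode
  decide +kernel

theorem fanoColoring_le (s : Finset (Fin 7)) : fanoColoring s ≤ 5 := by
  unfold fanoColoring
  split_ifs <;> norm_num

theorem fanoColoring_spec (s t : Finset (Fin 7)) (hst : s ≠ t)
    (h : fanoColoring s = fanoColoring t) (h0 : fanoColoring s ≠ 0) :
    fanoColoring s + 1 ≤ #(s ∆ t) := by
  have h1 : Even #s → Even #t → 2 ≤ #(s ∆ t) := by
    intro hs ht
    have heven := (isParity_even s t).2 (by simp [hs, ht])
    have hpos : #(s ∆ t) ≠ 0 := by
      rw [Ne, card_eq_zero]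
      exact fun h => hst (symmDiff_eq_bot.1 h)
    obtain ⟨k, hk⟩ := heven
    omega
  have h4 : (s = {1} ∨ s = {0, 3, 4, 5, 6}) → (t = {1} ∨ t = {0, 3, 4, 5, 6}) →
      6 ≤ #(s ∆ t) := by
    rintro (rfl | rfl) (rfl | rfl) <;> first | exact absurd rfl hst | decide
  have h5 : (s = {2} ∨ s = {0, 1, 4, 5, 6}) → (t = {2} ∨ t = {0, 1, 4, 5, 6}) →
      6 ≤ #(s ∆ t) := by
    rintro (rfl | rfl) (rfl | rfl) <;> first | exact absurd rfl hst | decide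
  have h2 := fun hs ht => isCode_fanoCode s hs t ht hst
  have h3 := fun hs ht => isCode_fanoCodeTranslate s hs t ht hst
  unfold fanoColoring at h h0 ⊢
  split_ifs at h h0 ⊢ <;> first | omega | skip
  · exact h1 ‹_› ‹_›
  · have := h2 ‹_› ‹_›
    omega
  · exact h3 ‹_› ‹_›
  · have := h4 ‹_› ‹_›
    omega
  · exact h5 ‹_› ‹_›

theorem packingColorable_hypercube_seven : PackingColorable (hypercube 7) 49 := by
  refine packingColorable_of_partial (m := 5) (r := 44) (fun v => fanoColoring (binarySupport v))
    (fun v => fanoColoring_le _) (fun u v huv h h0 => ?_) ?_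
  · rw [edist_hypercube, hammingDist_eq_card_symmDiff, Nat.cast_le]
    exact fanoColoring_spec _ _ (binarySupport_injective.ne huv) h h0
  · rw [← card_fanoColoring_eq_zero]
    exact card_le_card_of_injOn binarySupport (fun v => by simp) binarySupport_injective.injOn

theorem packingChromaticNumber_hypercube_seven : packingChromaticNumber (hypercube 7) = 49 :=
  le_antisymm (Nat.sInf_le packingColorable_hypercube_seven) le_packingChromaticNumber_seven

end SevenUpperBound

theorem mainTheorem3 :
    -- the values for the 7-dimensional hypercube
    packingChromaticNumber (hypercube 7) = 49 ∧
    Fintype.card (Fin 7 → ZMod 2) = 128 ∧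
    max (packingChromaticNumber (hypercube 7) * Fintype.card (Fin 7 → ZMod 2))
        (packingChromaticNumber (hypercube 7) * Fintype.card (Fin 7 → ZMod 2)) = 6272 ∧
    -- the 14-dimensional hypercube is the Cartesian square of the 7-dimensional one
    Nonempty ((hypercube 7).boxProd (hypercube 7) ≃g hypercube 14) ∧
    -- in every packing coloring of the 14-dimensional hypercube, colors 1, ..., 13 cover at most
    -- 9958 vertices, and at least 6426 vertices have a color that no other vertex has
    (∀ c : (Fin 14 → ZMod 2) → ℕ, IsPackingColoring (hypercube 14) c →
      {v | 1 ≤ c v ∧ c v ≤ 13}.ncard ≤ 9958 ∧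
      6426 ≤ {v | ∀ w, c w = c v → w = v}.ncard) ∧
    6439 ≤ packingChromaticNumber (hypercube 14) ∧
    -- the inequality fails for two copies of the 7-dimensional hypercube
    ¬ packingChromaticNumber ((hypercube 7).boxProd (hypercube 7)) ≤
      max (packingChromaticNumber (hypercube 7) * Fintype.card (Fin 7 → ZMod 2))
        (packingChromaticNumber (hypercube 7) * Fintype.card (Fin 7 → ZMod 2)) ∧
    -- hence it does not hold for arbitrary finite graphs
    ¬ ∀ (V W : Type) [Fintype V] [Fintype W] (G : SimpleGraph V) (H : SimpleGraph W),
      packingChromaticNumber (G.boxProd H) ≤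
        max (packingChromaticNumber G * Fintype.card W)
          (packingChromaticNumber H * Fintype.card V) := by
  have hcard : Fintype.card (Fin 7 → ZMod 2) = 128 := by
    rw [Fintype.card_fun, ZMod.card, Fintype.card_fin]
    norm_num
  have hfail : ¬packingChromaticNumber ((hypercube 7).boxProd (hypercube 7)) ≤
      max (packingChromaticNumber (hypercube 7) * Fintype.card (Fin 7 → ZMod 2))
        (packingChromaticNumber (hypercube 7) * Fintype.card (Fin 7 → ZMod 2)) := by
    rw [packingChromaticNumber_congr (hypercubeBoxProdIso 7 7),
      packingChromaticNumber_hypercube_seven, hcard, max_self]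
    exact not_le.2 (lt_of_lt_of_le (by norm_num) le_packingChromaticNumber_fourteen)
  refine ⟨packingChromaticNumber_hypercube_seven, hcard, ?_, ⟨hypercubeBoxProdIso 7 7⟩,
    fun c hc => ?_, le_packingChromaticNumber_fourteen, hfail, fun h => hfail (h _ _ _ _)⟩
  · rw [packingChromaticNumber_hypercube_seven, hcard, max_self]
  · have h1 : {v | 1 ≤ c v ∧ c v ≤ 13}.ncard = #{v | 1 ≤ c v ∧ c v ≤ 13} := by
      rw [← Set.ncard_coe_finset, coe_filter]
      simp
    have h2 := hc.card_fourteen_le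
    refine ⟨h1.trans_le h2, ?_⟩
    have h3 : {v | 1 ≤ c v ∧ c v ≤ 13}ᶜ ⊆ {v | ∀ w, c w = c v → w = v} := by
      intro v hv w hw
      have hpos := hc.1 v
      have hlarge : 14 ≤ c v := by
        simp only [Set.mem_compl_iff, Set.mem_ofPred_eq] at hv
        omega
      exact hc.eq_of_le hw (by omega)
    have h4 := Set.ncard_le_ncard h3 (Set.toFinite _)
    have h5 := Set.ncard_add_ncard_compl {v | 1 ≤ c v ∧ c v ≤ 13}
    rw [Nat.card_eq_fintype_card, Fintype.card_fun, ZMod.card, Fintype.card_fin] at h5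
    norm_num at h5
    omega
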